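/- All graphs are simple and $\log$ is the logarithm to base $2$. For a graph $H$, an integer $n\ge 0$ and a real number $x$, let $\mathrm{RT}(n,H,x)$ be the maximum number of edges of an $H$-free graph on $n$ vertices with independence number less than $x$ (and $0$ if there is no such graph). For a function $g:\mathbb N\to\mathbb R$ let $$\overline{\mathrm{RT}}(H,g)=\limsup_{n\to\infty}\frac{\mathrm{RT}(n,H,g(n))}{n^2},\qquad \underline{\mathrm{RT}}(H,g)=\liminf_{n\to\infty}\frac{\mathrm{RT}(n,H,g(n))}{n^2},$$ and, if the two are equal, denote their common value by $\mathrm{RT}(H,g)$. For integers $t\ge 2$, $n\ge 0$ let $Q(t,n)$ be the minimum independence number of a $K_t$-free graph on $n$ vertices. **Theorem.** Let $p\ge 2$ and $q\ge 2$ be integers, let $\omega:\mathbb N\to\mathbb R$ be any function with $\omega(n)\to\infty$, and let $f(n)=n\,2^{-\omega(n)(\log n)^{1-1/q}}$. Then: (a) With respect to the function $n\mapsto Q(p,\lceil f(n)\rceil)$, $$\overline{\mathrm{RT}}\bigl(K_{pq},\,Q(p,\lceil f\rceil)\bigr)\le \frac12\Bigl(1-\frac1{q-1}\Bigr).$$ (b)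 Let $0\le i\le p-1$ and $t=\bigl\lfloor\frac{pq-i-1}{q-1}\bigr\rfloor$. Then $t\ge p$, and for every function $g:\mathbb N\to\mathbb R$ such that $$Q\Bigl(t+1,\Bigl\lfloor\frac{n}{q-1}\Bigr\rfloor\Bigr)< g(n)\le Q\bigl(p,\lceil f(n)\rceil\bigr)$$ for all sufficiently large $n$, the Ramsey–Turán density $\mathrm{RT}(K_{pq-i},g)$ exists and $$\mathrm{RT}(K_{pq-i},g)=\frac12\Bigl(1-\frac1{q-1}\Bigr).$$ -/

import Mathlib

namespace RamseyTuran

/-- The largest number of edges of an `H`-free graph on `n` vertices whose independence number is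
less than `x`. The set of edge counts is finite; if there is no such graph, the value is `0`. -/
noncomputable def maxEdges {W : Type} (n : ℕ) (H : SimpleGraph W) (x : ℝ) : ℕ :=
  sSup {e : ℕ | ∃ G : SimpleGraph (Fin n),
    H.Free G ∧ (G.indepNum : ℝ) < x ∧ G.edgeSet.ncard = e}

/-- The upper Ramsey–Turán density of `H` with respect to `f`. The sequence has values in
`[0, 1/2]`, so the real `limsup` is the usual one. -/
noncomputable def upperDensity {W : Type} (H : SimpleGraph W) (f : ℕ → ℝ) : ℝ :=
  Filter.limsup (fun n : ℕ => (maxEdges n H (f n) : ℝ) / (n : ℝ) ^ 2) Filter.atTop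

/-- The lower Ramsey–Turán density of `H` with respect to `f`. -/
noncomputable def lowerDensity {W : Type} (H : SimpleGraph W) (f : ℕ → ℝ) : ℝ :=
  Filter.liminf (fun n : ℕ => (maxEdges n H (f n) : ℝ) / (n : ℝ) ^ 2) Filter.atTop

/-- The Ramsey–Turán density of `H` with respect to `f` exists and equals `c`. -/
def HasDensity {W : Type} (H : SimpleGraph W) (f : ℕ → ℝ) (c : ℝ) : Prop :=
  upperDensity H f = c ∧ lowerDensity H f = c

/-- The complete graph on `s` vertices. -/
abbrev K (s : ℕ) : SimpleGraph (Fin s) := ⊤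

/-- The inverse Ramsey function: the minimum independence number of a graph on `n` vertices that
contains no clique on `t` vertices. -/
noncomputable def Q (t n : ℕ) : ℕ :=
  sInf {a : ℕ | ∃ G : SimpleGraph (Fin n), G.CliqueFree t ∧ G.indepNum = a}

/-- The function `n · 2 ^ (-ω(n) (log₂ n) ^ (1 - 1/q))`. -/
noncomputable def scale (q : ℕ) (ω : ℕ → ℝ) (n : ℕ) : ℝ :=
  (n : ℝ) * (2 : ℝ) ^ (-(ω n * (Real.logb 2 (n : ℝ)) ^ (1 - 1 / (q : ℝ))))

end RamseyTuran

/-! The upper bound is iterated dependent random choice. A graph with more edges than the balanced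
complete `(q - 1)`-partite graph, by a margin `ε * n ^ 2`, contains a positive proportion of all
`q`-cliques (`exists_le_card_cliqueTuples`). If `k + 1`-cliques have density `d (k + 1)`, dependent
random choice gives `m` vertices among which any `p` have `k`-cliques of density `d k` in their
common neighbourhood. Independence number below `Q p m` puts a `p`-clique among these `m` vertices;
one continues inside its common neighbourhood. After `q` rounds the `p`-cliques join to a `K_{pq}`
(`exists_isNClique_of_card_cliqueTuples`). With `L = log n`, the densities fall from a constant at
`k = q` to `2 ^ (-c * L ^ (1 - 1 / q))` at `k = 1`, which is why the scale has this exponent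
(`eventually_exists_densities`).

For the lower bound, take `q - 1` copies of an extremal `K_{t+1}`-free graph on `⌊n / (q - 1)⌋`
vertices and join them almost completely. Cliques have at most `t * (q - 1) < pq - i` vertices. To
use all `n` vertices without raising the independence number, some copies receive a twin of a vertex
`u`, which may enlarge a clique by one. Deleting few edges to the next copy makes that copy lose a
clique vertex in return, while no independent set grows (`chain`, `exists_dense_cliqueFree`). -/

namespace RamseyTuran

open Finset Filter

/-! ### Dependent random choice and its iteration along clique counts. -/

section Counting

variable {V Y : Type*} [Fintype V] [DecidableEq V]

/-- Dependent random choice: if the sets `D v` have average density at least `δ`, then there is a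
large set of indices in which any `p` of the sets `D v` have a large common intersection. -/
theorem exists_rich_subset [Fintype Y] [DecidableEq Y] [Nonempty Y] (D : V → Finset Y) (p s : ℕ)
    {δ δ' m : ℝ} (hδ : 0 ≤ δ) (hδ' : 0 ≤ δ') (hm : 0 < m)
    (hD : δ * (Fintype.card V * Fintype.card Y) ≤ ∑ v, (#(D v) : ℝ))
    (h1 : m + 1 ≤ Fintype.card V * δ ^ s) (h2 : (Fintype.card V : ℝ) ^ (p + 1) * δ' ^ s ≤ 1) :
    ∃ U : Finset V, m ≤ #U ∧
      ∀ T ⊆ U, #T = p → δ' * Fintype.card Y ≤ #{y | ∀ v ∈ T, y ∈ D v} := by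
  set n : ℝ := (Fintype.card V : ℝ) with hn
  set N : ℝ := (Fintype.card Y : ℝ) with hN
  have hn0 : 0 ≤ n := by positivity
  have hnpos : 0 < n := by
    rcases hn0.lt_or_eq with h | h
    · exact h
    · rw [← h] at h1; linarith
  have hNpos : 0 < N := by rw [hN]; exact_mod_cast Fintype.card_pos
  -- Sample `s` points of `Y` and keep the indices whose sets contain them all; `B` collects the
  -- `p`-sets with too small an intersection.
  let U : (Fin s → Y) → Finset V := fun x => {v | ∀ i, x i ∈ D v}
  let C : Finset V → Finset Y := fun T => {y | ∀ v ∈ T, y ∈ D v}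
  let B : Finset (Finset V) := {T ∈ powersetCard p univ | (#(C T) : ℝ) < δ' * N}
  have hB : (#B : ℝ) ≤ n ^ p := by
    have : #B ≤ Fintype.card V ^ p :=
      (card_filter_le _ _).trans (by rw [card_powersetCard]; exact Nat.choose_le_pow _ _)
    rw [hn]; exact_mod_cast this
  have hU : ∑ x, (#(U x) : ℝ) = ∑ v, (#(D v) : ℝ) ^ s := by
    have : ∑ x, #(U x) = ∑ v, #(D v) ^ s := by
      simp only [U, card_filter]
      rw [sum_comm]
      refine sum_congr rfl fun v _ => ?_
      rw [← card_filter]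
      have : ({x : Fin s → Y | ∀ i, x i ∈ D v} : Finset _) = Fintype.piFinset fun _ => D v := by
        ext x; simp
      rw [this]; simp
    exact_mod_cast this
  have hbad : ∑ x, (#{T ∈ B | T ⊆ U x} : ℝ) = ∑ T ∈ B, (#(C T) : ℝ) ^ s := by
    have : ∑ x, #{T ∈ B | T ⊆ U x} = ∑ T ∈ B, #(C T) ^ s := by
      simp only [card_filter]
      rw [sum_comm]
      refine sum_congr rfl fun T _ => ?_
      rw [← card_filter]
      have : ({x : Fin s → Y | T ⊆ U x} : Finset _) = Fintype.piFinset fun _ => C T := by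
        ext x
        simp only [mem_filter, mem_univ, true_and, subset_iff, U, C, Fintype.mem_piFinset]
        exact ⟨fun h i v hv => h hv i, fun h v hv i => h i v hv⟩
      rw [this]; simp
    exact_mod_cast this
  have hbad' : ∑ x, (#{T ∈ B | T ⊆ U x} : ℝ) ≤ n ^ p * (δ' * N) ^ s := by
    rw [hbad]
    calc ∑ T ∈ B, (#(C T) : ℝ) ^ s ≤ ∑ _T ∈ B, (δ' * N) ^ s := by
          refine sum_le_sum fun T hT => ?_
          have := (mem_filter.mp hT).2.le
          gcongr
      _ = #B * (δ' * N) ^ s := by simp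
      _ ≤ _ := by gcongr
  have hjensen : n * (δ * N) ^ s ≤ ∑ v, (#(D v) : ℝ) ^ s := by
    have h := Real.pow_arith_mean_le_arith_mean_pow univ (fun _ : V => 1 / n)
      (fun v => (#(D v) : ℝ)) (fun _ _ => by positivity)
      (by simp only [sum_const, card_univ, nsmul_eq_mul]; rw [← hn]; field_simp)
      (fun _ _ => by positivity) s
    rw [← mul_sum, ← mul_sum] at h
    have h3 : δ * N ≤ 1 / n * ∑ v, (#(D v) : ℝ) := by
      rw [one_div, inv_mul_eq_div, le_div_iff₀ hnpos]; linarith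
    have h4 : (δ * N) ^ s ≤ 1 / n * ∑ v, (#(D v) : ℝ) ^ s :=
      (pow_le_pow_left₀ (by positivity) h3 s).trans h
    rw [one_div, inv_mul_eq_div, le_div_iff₀ hnpos] at h4
    linarith
  -- Each bad set is charged `n ≥ #(U x)`, so a sample reaching the positive average `m` contains no
  -- bad set at all and nothing has to be deleted.
  have hsum : ∑ _x : Fin s → Y, m ≤ ∑ x, ((#(U x) : ℝ) - n * #{T ∈ B | T ⊆ U x}) := by
    rw [sum_sub_distrib, ← mul_sum, hU]
    have hcard : ∑ _x : Fin s → Y, m = N ^ s * m := by simp [hN]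
    rw [hcard]
    have e1 := mul_le_mul_of_nonneg_left hbad' hn0
    have e2 := mul_le_mul_of_nonneg_right h1 (pow_nonneg hNpos.le s)
    have e3 := mul_le_mul_of_nonneg_right h2 (pow_nonneg hNpos.le s)
    rw [mul_pow] at e1 hjensen
    rw [pow_succ] at e3
    nlinarith
  obtain ⟨x, -, hx⟩ := exists_le_of_sum_le univ_nonempty hsum
  have hUn : (#(U x) : ℝ) ≤ n := by rw [hn]; exact_mod_cast card_le_univ _
  have hempty : #{T ∈ B | T ⊆ U x} = 0 := by
    by_contra h
    have h' : (1 : ℝ) ≤ #{T ∈ B | T ⊆ U x} := by exact_mod_cast Nat.one_le_iff_ne_zero.mpr h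
    nlinarith
  refine ⟨U x, ?_, fun T hT hTp => ?_⟩
  · rw [hempty] at hx; simpa using hx
  · by_contra h
    rw [card_eq_zero] at hempty
    have : T ∈ ({T ∈ B | T ⊆ U x} : Finset _) :=
      mem_filter.mpr ⟨mem_filter.mpr ⟨by simp [mem_powersetCard, hTp], not_le.mp h⟩, hT⟩
    simp [hempty] at this

open scoped Classical in
/-- The `k`-tuples of pairwise adjacent vertices of `W`. -/
noncomputable def cliqueTuples (G : SimpleGraph V) (k : ℕ) (W : Finset V) : Finset (Fin k → V) :=
  {x | (∀ i, x i ∈ W) ∧ ∀ i j, i ≠ j → G.Adj (x i) (x j)}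

theorem mem_cliqueTuples {G : SimpleGraph V} {k : ℕ} {W : Finset V} {x : Fin k → V} :
    x ∈ cliqueTuples G k W ↔ (∀ i, x i ∈ W) ∧ ∀ i j, i ≠ j → G.Adj (x i) (x j) := by
  simp [cliqueTuples]

theorem card_cliqueTuples_zero (G : SimpleGraph V) (W : Finset V) :
    #(cliqueTuples G 0 W) = 1 := by
  rw [card_eq_one]
  refine ⟨Fin.elim0, ?_⟩
  ext x
  simp [mem_cliqueTuples, Subsingleton.elim x Fin.elim0]

open scoped Classical in
theorem card_cliqueTuples_succ (G : SimpleGraph V) (k : ℕ) (W : Finset V) :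
    #(cliqueTuples G (k + 1) W) = ∑ v ∈ W, #(cliqueTuples G k {w ∈ W | G.Adj v w}) := by
  rw [card_eq_sum_card_fiberwise (f := fun x => x 0) (t := W)
    (fun x hx => (mem_cliqueTuples.mp hx).1 0)]
  refine sum_congr rfl fun v hv => ?_
  refine card_nbij' (fun x => Fin.tail x) (fun y => Fin.cons v y) ?_ ?_ ?_ ?_
  · intro x hx
    simp only [coe_filter, Set.mem_ofPred_eq, mem_cliqueTuples] at hx
    obtain ⟨⟨hW, hadj⟩, rfl⟩ := hx
    simp only [mem_coe, mem_cliqueTuples, mem_filter, Fin.tail]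
    exact ⟨fun i => ⟨hW _, hadj _ _ (Fin.succ_ne_zero i).symm⟩,
      fun i j hij => hadj _ _ (by simpa using hij)⟩
  · intro y hy
    simp only [mem_coe, mem_cliqueTuples, mem_filter] at hy
    simp only [coe_filter, Set.mem_ofPred_eq, mem_cliqueTuples, Fin.cons_zero, and_true]
    refine ⟨fun i => ?_, fun i j hij => ?_⟩
    · refine Fin.cases hv (fun i => ?_) i
      exact (hy.1 i).1
    · induction i using Fin.cases with
      | zero =>
        induction j using Fin.cases with
        | zero => exact absurd rfl hij
        | succ j => exact (hy.1 j).2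
      | succ i =>
        induction j using Fin.cases with
        | zero => exact (hy.1 i).2.symm
        | succ j => exact hy.2 i j (by simpa using hij)
  · intro x hx
    simp only [coe_filter, Set.mem_ofPred_eq] at hx
    rw [← hx.2]; exact Fin.cons_self_tail x
  · intro y _
    exact Fin.tail_cons _ _

theorem card_cliqueTuples_one (G : SimpleGraph V) (W : Finset V) :
    #(cliqueTuples G 1 W) = #W := by
  classical
  rw [card_cliqueTuples_succ]
  simp [card_cliqueTuples_zero]

/-- If every `m` vertices span a `p`-clique, then a vertex set with sufficiently many `k`-cliques
contains a `p * k`-clique. -/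
theorem exists_isNClique_of_card_cliqueTuples (G : SimpleGraph V) {p m q : ℕ} (hp : 0 < p)
    (hm : 0 < m) (hG : ∀ U : Finset V, m ≤ #U → ∃ T ⊆ U, G.IsNClique p T) {d : ℕ → ℝ}
    (hd : ∀ k, 0 < d k) (h1 : (m : ℝ) ≤ Fintype.card V * d 1)
    (hstep : ∀ k, 1 ≤ k → k < q → ∃ s : ℕ, (m : ℝ) + 1 ≤ Fintype.card V * d (k + 1) ^ s ∧
      (Fintype.card V : ℝ) ^ (p + 1) * d k ^ s ≤ 1)
    (k : ℕ) (hk : 1 ≤ k) (hkq : k ≤ q) (W : Finset V)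
    (hW : d k * (Fintype.card V : ℝ) ^ k ≤ #(cliqueTuples G k W)) :
    ∃ T ⊆ W, G.IsNClique (p * k) T := by
  classical
  induction k, hk using Nat.le_induction generalizing W with
  | base =>
    rw [card_cliqueTuples_one] at hW
    rw [mul_one]
    refine hG W ?_
    have : (m : ℝ) ≤ #W := by linarith
    exact_mod_cast this
  | succ k hk ih =>
    have hV : Nonempty V := by
      rw [← Fintype.card_pos_iff]
      by_contra h
      have h0 : Fintype.card V = 0 := by omega
      have : (m : ℝ) ≤ 0 := by simpa [h0] using h1
      have : (0 : ℝ) < m := by exact_mod_cast hm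
      linarith
    obtain ⟨s, hs1, hs2⟩ := hstep k hk hkq
    -- Empty sets outside `W` force the clique found below to lie in `W`, because its common
    -- intersection is nonempty.
    let D : V → Finset (Fin k → V) := fun v =>
      if v ∈ W then cliqueTuples G k {w ∈ W | G.Adj v w} else ∅
    have hDsum : ∑ v, #(D v) = #(cliqueTuples G (k + 1) W) := by
      rw [card_cliqueTuples_succ, ← sum_subset (subset_univ W)]
      · exact sum_congr rfl fun v hv => by simp [D, hv]
      · intro v _ hv; simp [D, hv]
    have hcard : (Fintype.card (Fin k → V) : ℝ) = (Fintype.card V : ℝ) ^ k := by simp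
    obtain ⟨U, hUm, hU⟩ := exists_rich_subset D p s (hd (k + 1)).le (hd k).le
      (by exact_mod_cast hm) (by
        rw [hcard, ← pow_succ']
        refine hW.trans ?_
        rw [← hDsum]; push_cast; rfl) hs1 hs2
    obtain ⟨T, hTU, hT⟩ := hG U (by exact_mod_cast hUm)
    have hrich := hU T hTU hT.card_eq
    rw [hcard] at hrich
    have hTne : T.Nonempty := by rw [← card_pos, hT.card_eq]; exact hp
    let W' : Finset V := {w ∈ W | ∀ v ∈ T, G.Adj v w}
    have hsub : ({y | ∀ v ∈ T, y ∈ D v} : Finset (Fin k → V)) ⊆ cliqueTuples G k W' := by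
      intro y hy
      simp only [mem_filter, mem_univ, true_and] at hy
      have hy' : ∀ v ∈ T, y ∈ cliqueTuples G k {w ∈ W | G.Adj v w} := fun v hv => by
        have := hy v hv
        by_cases h : v ∈ W
        · simpa [D, h] using this
        · simp [D, h] at this
      obtain ⟨v₀, hv₀⟩ := hTne
      simp only [mem_cliqueTuples, mem_filter] at hy'
      simp only [mem_cliqueTuples, W', mem_filter]
      exact ⟨fun i => ⟨((hy' v₀ hv₀).1 i).1, fun v hv => ((hy' v hv).1 i).2⟩, (hy' v₀ hv₀).2⟩
    obtain ⟨T', hT'W, hT'⟩ := ih (by omega) W'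
      (hrich.trans (by exact_mod_cast card_le_card hsub))
    have hTW : T ⊆ W := by
      have hpos : (0 : ℝ) < #({y | ∀ v ∈ T, y ∈ D v} : Finset (Fin k → V)) :=
        lt_of_lt_of_le (mul_pos (hd k) (pow_pos (by exact_mod_cast Fintype.card_pos) k)) hrich
      have hpos' : 0 < #({y | ∀ v ∈ T, y ∈ D v} : Finset (Fin k → V)) := by exact_mod_cast hpos
      obtain ⟨y, hy⟩ := card_pos.mp hpos'
      simp only [mem_filter, mem_univ, true_and] at hy
      intro v hv
      by_contra h
      simpa [D, h] using hy v hv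
    have hadj : ∀ v ∈ T, ∀ w ∈ T', G.Adj v w := fun v hv w hw =>
      (mem_filter.mp (hT'W hw)).2 v hv
    refine ⟨T ∪ T', union_subset hTW (hT'W.trans (filter_subset _ _)), ?_⟩
    rw [SimpleGraph.isNClique_iff]
    constructor
    · intro a ha b hb hab
      simp only [coe_union, Set.mem_union, mem_coe] at ha hb
      rcases ha with ha | ha <;> rcases hb with hb | hb
      · exact hT.isClique ha hb hab
      · exact hadj a ha b hb
      · exact (hadj b hb a ha).symm
      · exact hT'.isClique ha hb hab
    · rw [card_union_of_disjoint, hT.card_eq, hT'.card_eq]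
      · ring
      · rw [disjoint_left]
        intro a ha ha'
        exact (hadj a ha a ha').ne rfl

end Counting

/-! ### Supersaturation for cliques via large minimum degree. -/

section Supersaturation

variable {V : Type*} [Fintype V] [DecidableEq V] (G : SimpleGraph V)

open scoped Classical in
/-- A vertex set in which all non-degrees are at most `β` has many cliques. -/
theorem pow_le_card_cliqueTuples {β η : ℝ} (hβ : 0 ≤ β) (hη : 0 ≤ η) (W : Finset V)
    (hW : ∀ v ∈ W, (#{w ∈ W | ¬ G.Adj v w} : ℝ) ≤ β) (k : ℕ) (S : Finset V) (hS : S ⊆ W)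
    (hSη : η + (k - 1) * β ≤ #S) : η ^ k ≤ #(cliqueTuples G k S) := by
  induction k generalizing S with
  | zero => simp [card_cliqueTuples_zero]
  | succ k ih =>
    rw [card_cliqueTuples_succ]
    push_cast at hSη ⊢
    have hcard : η ≤ #S := by nlinarith [mul_nonneg (Nat.cast_nonneg (α := ℝ) k) hβ]
    calc η ^ (k + 1) = η * η ^ k := pow_succ' _ _
      _ ≤ #S * η ^ k := by gcongr
      _ = ∑ _v ∈ S, η ^ k := by simp
      _ ≤ _ := sum_le_sum fun v hv => ?_
    refine ih _ ((filter_subset _ _).trans hS) ?_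
    have h1 : (#{w ∈ S | G.Adj v w} : ℝ) + #{w ∈ S | ¬ G.Adj v w} = #S := by
      exact_mod_cast card_filter_add_card_filter_not (s := S) (fun w => G.Adj v w)
    have h2 : (#{w ∈ S | ¬ G.Adj v w} : ℝ) ≤ β :=
      le_trans (by exact_mod_cast card_le_card (filter_subset_filter _ hS)) (hW v (hS hv))
    linarith

open scoped Classical in
/-- A dense graph has a large vertex set inducing a subgraph of large minimum degree. -/
theorem exists_le_degree_subset {c ε : ℝ}
    (h : (c + ε) * (Fintype.card V : ℝ) ^ 2 + c * Fintype.card V ≤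
      ∑ v, (#{w | G.Adj v w} : ℝ)) :
    ∃ W : Finset V, (ε * (Fintype.card V : ℝ) ^ 2 + c * (#W * (#W + 1)) ≤ (#W : ℝ) ^ 2) ∧
      ∀ v ∈ W, c * #W ≤ #{w ∈ W | G.Adj v w} := by
  let e : Finset V → ℝ := fun W => ∑ v ∈ W, (#{w ∈ W | G.Adj v w} : ℝ)
  -- Deleting `v` lowers `e W` by twice its degree in `W` and the penalty by exactly `2 * c * #W`,
  -- so maximality is the degree condition.
  obtain ⟨W, -, hW⟩ := exists_max_image univ (fun W : Finset V => e W - c * (#W * (#W + 1)))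
    univ_nonempty
  refine ⟨W, ?_, fun v hv => ?_⟩
  · have h1 := hW univ (mem_univ _)
    have h2 : e W ≤ (#W : ℝ) ^ 2 := by
      calc e W ≤ ∑ _v ∈ W, (#W : ℝ) :=
            sum_le_sum fun v _ => by exact_mod_cast card_filter_le _ _
        _ = _ := by simp [sq]
    have h3 : e univ = ∑ v, (#{w | G.Adj v w} : ℝ) := rfl
    simp only [card_univ] at h1
    rw [h3] at h1
    nlinarith
  · have h1 := hW (W.erase v) (mem_univ _)
    have hc : (#W : ℝ) = #(W.erase v) + 1 := by
      exact_mod_cast (card_erase_add_one hv).symm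
    have he : e W = e (W.erase v) + 2 * #{w ∈ W | G.Adj v w} := by
      have hv' : v ∉ W.erase v := notMem_erase v W
      have hdeg : (#{w ∈ W | G.Adj v w} : ℝ) = #{w ∈ W.erase v | G.Adj v w} := by
        congr 2
        ext w
        simp only [mem_filter, mem_erase]
        exact ⟨fun h => ⟨⟨h.2.ne.symm, h.1⟩, h.2⟩, fun h => ⟨h.1.2, h.2⟩⟩
      have hsum : ∀ x ∈ W.erase v, (#{w ∈ W | G.Adj x w} : ℝ) =
          #{w ∈ W.erase v | G.Adj x w} + if G.Adj v x then 1 else 0 := by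
        intro x _
        conv_lhs => rw [← insert_erase hv]
        rw [filter_insert]
        by_cases hx : G.Adj x v
        · rw [if_pos hx, if_pos hx.symm, card_insert_of_notMem (by simp)]
          push_cast; ring
        · rw [if_neg hx, if_neg (fun h => hx h.symm)]; simp
      simp only [e]
      conv_lhs => rw [← insert_erase hv]
      rw [sum_insert hv', insert_erase hv, sum_congr rfl hsum, sum_add_distrib, sum_boole, hdeg]
      ring
    simp only [he] at h1
    rw [hc] at h1 ⊢
    nlinarith

open scoped Classical in
/-- Supersaturation: a graph whose edge density exceeds the Turán density of the `q`-clique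
contains a positive proportion of all `q`-cliques. -/
theorem exists_le_card_cliqueTuples {q : ℕ} (hq : 2 ≤ q) {ε : ℝ} (hε : 0 < ε) :
    ∃ δ : ℝ, 0 < δ ∧ ∃ N : ℕ, ∀ n ≥ N, ∀ G : SimpleGraph (Fin n),
      (1 - 1 / ((q : ℝ) - 1) + 3 * ε) * (n : ℝ) ^ 2 ≤ ∑ v, (#{w | G.Adj v w} : ℝ) →
      δ * (n : ℝ) ^ q ≤ #(cliqueTuples G q univ) := by
  have hq1 : (1 : ℝ) ≤ (q : ℝ) - 1 := by
    have : (2 : ℝ) ≤ q := by exact_mod_cast hq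
    linarith
  have hinv : 1 / ((q : ℝ) - 1) ≤ 1 := by rw [div_le_one (by linarith)]; exact hq1
  have hinv0 : 0 < 1 / ((q : ℝ) - 1) := by positivity
  set c : ℝ := 1 - 1 / ((q : ℝ) - 1) + ε with hc
  refine ⟨(ε * √ε) ^ q, by positivity, ⌈(1 + ε) / ε⌉₊ + 1, fun n hn G hG => ?_⟩
  have hn1 : (1 + ε) / ε ≤ n := (Nat.le_ceil _).trans (by exact_mod_cast (by omega))
  have hn0 : (0 : ℝ) < n := by exact_mod_cast (by omega : 0 < n)
  rw [div_le_iff₀ hε] at hn1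
  -- Of the `3 * ε`, one is in `c`, one makes `W` large, and one absorbs the linear term `c * n`.
  obtain ⟨W, hW, hdeg⟩ := exists_le_degree_subset G (c := c) (ε := ε) (by
    rw [Fintype.card_fin]
    refine le_trans ?_ hG
    have : c ≤ 1 + ε := by rw [hc]; linarith
    nlinarith)
  rw [Fintype.card_fin] at hW
  have hc0 : 0 < c := by rw [hc]; linarith
  have hW2 : ε * (n : ℝ) ^ 2 ≤ (#W : ℝ) ^ 2 := by
    have : 0 ≤ c * ((#W : ℝ) * (#W + 1)) := by positivity
    linarith
  have hWn : √ε * n ≤ #W := by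
    refine le_of_sq_le_sq ?_ (by positivity)
    rw [mul_pow, Real.sq_sqrt hε.le]; exact hW2
  have hnon : ∀ v ∈ W, (#{w ∈ W | ¬ G.Adj v w} : ℝ) ≤ (1 - c) * #W := by
    intro v hv
    have h1 : (#{w ∈ W | G.Adj v w} : ℝ) + #{w ∈ W | ¬ G.Adj v w} = #W := by
      exact_mod_cast card_filter_add_card_filter_not (s := W) (fun w => G.Adj v w)
    have := hdeg v hv
    linarith
  have hWne : W.Nonempty := by
    rw [← card_pos]
    have : (0 : ℝ) < #W := lt_of_lt_of_le (by positivity) hWn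
    exact_mod_cast this
  obtain ⟨v₀, hv₀⟩ := hWne
  have hβ : 0 ≤ (1 - c) * #W := le_trans (by positivity) (hnon v₀ hv₀)
  -- After `q - 1` greedy choices at least `(q - 1) * ε * #W ≥ ε * √ε * n` candidates remain.
  have key := pow_le_card_cliqueTuples G hβ (η := ε * √ε * n) (by positivity) W hnon q W
    subset_rfl (by
      have h1 : ((q : ℝ) - 1) * (1 - c) = 1 - ((q : ℝ) - 1) * ε := by
        rw [hc]; field_simp; ring
      have h2 : ε * (√ε * n) ≤ ε * #W := by gcongr
      have h3 : ε * (#W : ℝ) ≤ ((q : ℝ) - 1) * (ε * #W) :=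
        le_mul_of_one_le_left (by positivity) hq1
      rw [← mul_assoc, h1]
      nlinarith)
  rw [← mul_pow]
  refine key.trans ?_
  have : cliqueTuples G q W ⊆ cliqueTuples G q univ := fun x hx => by
    rw [mem_cliqueTuples] at hx ⊢
    exact ⟨fun _ => mem_univ _, hx.2⟩
  exact_mod_cast card_le_card this

end Supersaturation

/-! ### Choice of densities and sample sizes. -/

section Scale

theorem tendsto_logb_two_natCast : Tendsto (fun n : ℕ => Real.logb 2 (n : ℝ)) atTop atTop :=
  (Real.tendsto_logb_atTop (by norm_num)).comp tendsto_natCast_atTop_atTop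

/-- Densities for which dependent random choice can be iterated `q - 1` times. -/
theorem eventually_exists_densities (p : ℕ) {q : ℕ} (hq : 2 ≤ q) {ω : ℕ → ℝ}
    (hω : Tendsto ω atTop atTop) {δ : ℝ} (hδ : 0 < δ) :
    ∀ᶠ n : ℕ in atTop, ∃ d : ℕ → ℝ, (∀ k, 0 < d k) ∧ d q ≤ δ ∧
      (⌈scale q ω n⌉₊ : ℝ) ≤ n * d 1 ∧
      ∀ k, 1 ≤ k → k < q → ∃ s : ℕ, (⌈scale q ω n⌉₊ : ℝ) + 1 ≤ n * d (k + 1) ^ s ∧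
        (n : ℝ) ^ (p + 1) * d k ^ s ≤ 1 := by
  have hq0 : (0 : ℝ) < q := by exact_mod_cast (by omega : 0 < q)
  set c : ℝ := max 1 (-Real.logb 2 δ) with hc
  have hc1 : 1 ≤ c := le_max_left _ _
  have hcδ : (2 : ℝ) ^ (-c) ≤ δ := by
    calc (2 : ℝ) ^ (-c) ≤ 2 ^ (Real.logb 2 δ) :=
          Real.rpow_le_rpow_of_exponent_le (by norm_num) (by
            have := le_max_right 1 (-Real.logb 2 δ); linarith)
      _ = δ := Real.rpow_logb (by norm_num) (by norm_num) hδ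
  have hroot : Tendsto (fun n : ℕ => Real.logb 2 (n : ℝ) ^ (1 / (q : ℝ))) atTop atTop :=
    (tendsto_rpow_atTop (by positivity)).comp tendsto_logb_two_natCast
  filter_upwards [tendsto_logb_two_natCast.eventually_ge_atTop 4,
    hroot.eventually_ge_atTop (2 * (c * (p + 3))), hω.eventually_ge_atTop (c * (p + 3) + 1),
    eventually_ge_atTop 1] with n hL hLroot hωn hn
  set L : ℝ := Real.logb 2 (n : ℝ) with hLdef
  have hL0 : 0 < L := by linarith
  have hn0 : (0 : ℝ) < n := by exact_mod_cast hn
  have hnL : (n : ℝ) = 2 ^ L := (Real.rpow_logb (by norm_num) (by norm_num) hn0).symm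
  set E : ℝ := L ^ (1 - 1 / (q : ℝ)) with hE
  have hexp : 0 ≤ 1 - 1 / (q : ℝ) := by
    have : 1 / (q : ℝ) ≤ 1 := by
      rw [div_le_one hq0]; exact_mod_cast (by omega : 1 ≤ q)
    linarith
  have hE1 : 1 ≤ E := Real.one_le_rpow (by linarith) hexp
  have hEL : E * L ^ (1 / (q : ℝ)) = L := by
    rw [hE, ← Real.rpow_add hL0]; simp
  have hbig : 2 + c * (p + 3) * E ≤ L := by
    have : 2 * (c * (p + 3)) * E ≤ L := by
      rw [← hEL, mul_comm]; gcongr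
    linarith
  -- All lower bounds to be met are at least `X`. As `ω n` exceeds `c * (p + 3)` by `1` and `1 ≤ E`,
  -- the scale is at most `X / 2`; `4 ≤ X` pays for the ceiling and the extra `1`.
  set X : ℝ := n * 2 ^ (-(c * (p + 3) * E)) with hX
  have hX4 : 4 ≤ X := by
    rw [hX, hnL, ← Real.rpow_add (by norm_num)]
    calc (4 : ℝ) = 2 ^ (2 : ℝ) := by norm_num
      _ ≤ _ := Real.rpow_le_rpow_of_exponent_le (by norm_num) (by linarith)
  have hscale : scale q ω n ≤ X / 2 := by
    have h1 : X / 2 = n * 2 ^ (-(c * (p + 3) * E) + (-1)) := by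
      rw [hX, Real.rpow_add (by norm_num), Real.rpow_neg_one]; ring
    rw [h1, scale]
    refine mul_le_mul_of_nonneg_left ?_ hn0.le
    refine Real.rpow_le_rpow_of_exponent_le (by norm_num) ?_
    have : (c * (p + 3) + 1) * E ≤ ω n * E := by gcongr
    nlinarith
  have hscale0 : 0 ≤ scale q ω n := by unfold scale; positivity
  have hceil : (⌈scale q ω n⌉₊ : ℝ) + 1 ≤ X := by
    have := Nat.ceil_lt_add_one hscale0
    linarith
  -- Consecutive exponents differ by a factor `L ^ (1 / q)`. With `s` about `L ^ (k / q)`, `d k ^ s`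
  -- is a power of `n⁻¹`, while `d (k + 1) ^ s` costs only `2 ^ (-O(E))`.
  let d : ℕ → ℝ := fun k => 2 ^ (-(c * L ^ (((q : ℝ) - k) / q)))
  have hdpow : ∀ k s : ℕ, d k ^ s = 2 ^ (-(c * L ^ (((q : ℝ) - k) / q) * s)) := by
    intro k s
    rw [← Real.rpow_natCast, ← Real.rpow_mul (by norm_num)]
    congr 1; ring
  refine ⟨d, fun k => by positivity, ?_, ?_, fun k hk hkq => ?_⟩
  · simpa [d] using hcδ
  · have h1 : X ≤ n * d 1 := by
      refine mul_le_mul_of_nonneg_left ?_ hn0.le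
      refine Real.rpow_le_rpow_of_exponent_le (by norm_num) ?_
      have h2 : ((q : ℝ) - (1 : ℕ)) / q = 1 - 1 / (q : ℝ) := by push_cast; field_simp
      rw [h2, ← hE]
      have : c * E * 1 ≤ c * E * (p + 3) := by
        have : (0 : ℝ) ≤ p := by positivity
        gcongr; linarith
      linarith
    linarith
  · set s : ℕ := ⌈((p : ℝ) + 2) * L ^ ((k : ℝ) / q)⌉₊ with hs
    have hs1 : ((p : ℝ) + 2) * L ^ ((k : ℝ) / q) ≤ s := Nat.le_ceil _
    have hs2 : (s : ℝ) ≤ ((p : ℝ) + 3) * L ^ ((k : ℝ) / q) := by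
      have h1 := (Nat.ceil_lt_add_one
        (by positivity : 0 ≤ ((p : ℝ) + 2) * L ^ ((k : ℝ) / q))).le
      have h2 : 1 ≤ L ^ ((k : ℝ) / q) := Real.one_le_rpow (by linarith) (by positivity)
      rw [← hs] at h1
      linarith
    refine ⟨s, ?_, ?_⟩
    · refine hceil.trans ?_
      rw [hdpow]
      refine mul_le_mul_of_nonneg_left ?_ hn0.le
      refine Real.rpow_le_rpow_of_exponent_le (by norm_num) ?_
      have h1 : L ^ (((q : ℝ) - (k + 1 : ℕ)) / q) * L ^ ((k : ℝ) / q) = E := by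
        rw [← Real.rpow_add hL0, hE]
        congr 1; push_cast; field_simp; ring
      have h2 : c * L ^ (((q : ℝ) - (k + 1 : ℕ)) / q) * s ≤
          c * L ^ (((q : ℝ) - (k + 1 : ℕ)) / q) * (((p : ℝ) + 3) * L ^ ((k : ℝ) / q)) := by
        gcongr
      have h3 : c * L ^ (((q : ℝ) - (k + 1 : ℕ)) / q) * (((p : ℝ) + 3) * L ^ ((k : ℝ) / q)) =
          c * (p + 3) * E := by rw [← h1]; ring
      linarith
    · rw [hdpow, ← Real.rpow_natCast, hnL, ← Real.rpow_mul (by norm_num),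
        ← Real.rpow_add (by norm_num)]
      refine Real.rpow_le_one_of_one_le_of_nonpos (by norm_num) ?_
      have h1 : L ^ (((q : ℝ) - k) / q) * L ^ ((k : ℝ) / q) = L := by
        rw [← Real.rpow_add hL0]
        have : ((q : ℝ) - k) / q + k / q = 1 := by field_simp; ring
        rw [this, Real.rpow_one]
      have h2 : L ^ (((q : ℝ) - k) / q) * (((p : ℝ) + 2) * L ^ ((k : ℝ) / q)) ≤
          L ^ (((q : ℝ) - k) / q) * s := by gcongr
      have h3 : 1 * (L ^ (((q : ℝ) - k) / q) * s) ≤ c * (L ^ (((q : ℝ) - k) / q) * s) := by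
        gcongr
      have h4 : L ^ (((q : ℝ) - k) / q) * (((p : ℝ) + 2) * L ^ ((k : ℝ) / q)) =
          (p + 2) * L := by rw [mul_left_comm, h1]
      push_cast
      nlinarith

end Scale

/-! ### The upper bound on the density. -/

section UpperBound

theorem indepNum_comap_le {V W : Type*} [Finite V] (G : SimpleGraph V)
    (f : W ↪ V) : (G.comap f).indepNum ≤ G.indepNum := by
  classical
  have : Finite W := Finite.of_injective f f.injective
  obtain ⟨s, hs⟩ := (G.comap f).exists_isNIndepSet_indepNum
  rw [← hs.card_eq, ← card_map f]
  refine SimpleGraph.IsIndepSet.card_le_indepNum ?_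
  intro a ha b hb hab
  simp only [coe_map, Set.mem_image, mem_coe] at ha hb
  obtain ⟨a, ha, rfl⟩ := ha
  obtain ⟨b, hb, rfl⟩ := hb
  exact hs.isIndepSet ha hb (fun h => hab (by rw [h]))

theorem Q_le_indepNum {t n : ℕ} {G : SimpleGraph (Fin n)} (hG : G.CliqueFree t) :
    Q t n ≤ G.indepNum :=
  Nat.sInf_le ⟨G, hG, rfl⟩

/-- In a graph with independence number below `Q p m`, any `m` vertices contain a `p`-clique. -/
theorem exists_isNClique_of_indepNum_lt_Q {n p m : ℕ} {G : SimpleGraph (Fin n)}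
    (hG : G.indepNum < Q p m) (U : Finset (Fin n)) (hU : m ≤ #U) :
    ∃ T ⊆ U, G.IsNClique p T := by
  obtain ⟨U', hU'U, hU'⟩ := exists_subset_card_eq hU
  let f : Fin m ↪ Fin n := (U'.orderEmbOfFin hU').toEmbedding
  by_contra! h
  have hfree : (G.comap f).CliqueFree p := by
    intro s hs
    refine h (s.map f) ?_ ?_
    · intro x hx
      obtain ⟨y, -, rfl⟩ := mem_map.mp hx
      exact hU'U (orderEmbOfFin_mem U' hU' y)
    · rw [SimpleGraph.isNClique_iff, card_map]
      refine ⟨?_, hs.card_eq⟩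
      intro a ha b hb hab
      simp only [coe_map, Set.mem_image, mem_coe] at ha hb
      obtain ⟨a, ha, rfl⟩ := ha
      obtain ⟨b, hb, rfl⟩ := hb
      exact hs.isClique ha hb (fun h => hab (by rw [h]))
  have := Q_le_indepNum hfree
  have := indepNum_comap_le G f
  omega

open scoped Classical in
theorem sum_card_adj_eq_two_mul_ncard_edgeSet {V : Type*} [Fintype V] (G : SimpleGraph V) :
    ∑ v, (#{w | G.Adj v w} : ℝ) = 2 * G.edgeSet.ncard := by
  have h := G.sum_degrees_eq_twice_card_edges
  rw [← SimpleGraph.coe_edgeFinset, Set.ncard_coe_finset]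
  have hdeg : ∀ v, #{w | G.Adj v w} = G.degree v := fun v => by
    rw [← SimpleGraph.card_neighborFinset_eq_degree, SimpleGraph.neighborFinset_eq_filter]
  simp only [hdeg]
  exact_mod_cast h

/-- Asymptotically, a `K_{pq}`-free graph of small independence number has at most as many edges
as the balanced complete `(q - 1)`-partite graph. -/
theorem eventually_ncard_edgeSet_le {p q : ℕ} (hp : 2 ≤ p) (hq : 2 ≤ q) {ω : ℕ → ℝ}
    (hω : Tendsto ω atTop atTop) {ε : ℝ} (hε : 0 < ε) :
    ∀ᶠ n : ℕ in atTop, ∀ G : SimpleGraph (Fin n), G.CliqueFree (p * q) →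
      G.indepNum < Q p ⌈scale q ω n⌉₊ →
      (G.edgeSet.ncard : ℝ) ≤ (1 / 2 * (1 - 1 / ((q : ℝ) - 1)) + ε) * (n : ℝ) ^ 2 := by
  -- The degree sum counts edges twice, so an edge excess `ε` is a degree excess `2 * ε = 3 * (2 * ε
  -- / 3)`.
  obtain ⟨δ, hδ, N, hN⟩ := exists_le_card_cliqueTuples hq (by positivity : 0 < 2 * ε / 3)
  filter_upwards [eventually_exists_densities p hq hω hδ, eventually_ge_atTop N,
    eventually_ge_atTop 1] with n ⟨d, hd, hdq, hd1, hstep⟩ hnN hn G hfree hα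
  by_contra! h
  have hcount := hN n hnN G (by rw [sum_card_adj_eq_two_mul_ncard_edgeSet]; linarith)
  have hm : 0 < ⌈scale q ω n⌉₊ := by
    rw [Nat.ceil_pos]
    have : (0 : ℝ) < n := by exact_mod_cast hn
    unfold scale; positivity
  obtain ⟨T, -, hT⟩ := exists_isNClique_of_card_cliqueTuples G (by omega) hm
    (exists_isNClique_of_indepNum_lt_Q hα) hd (by simpa using hd1) (by simpa using hstep)
    q (by omega) le_rfl univ (by
      rw [Fintype.card_fin]
      refine le_trans ?_ hcount
      gcongr)
  exact hfree T hT

theorem maxEdges_le {W : Type} {n : ℕ} {H : SimpleGraph W} {x B : ℝ} (hB : 0 ≤ B)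
    (h : ∀ G : SimpleGraph (Fin n), H.Free G → (G.indepNum : ℝ) < x →
      (G.edgeSet.ncard : ℝ) ≤ B) : (maxEdges n H x : ℝ) ≤ B := by
  rw [← Nat.le_floor_iff hB]
  -- This also covers the empty set, whose supremum in `ℕ` is `0`.
  refine csSup_le' ?_
  rintro e ⟨G, hG, hα, rfl⟩
  exact Nat.le_floor (h G hG hα)

theorem ncard_edgeSet_le_maxEdges {W : Type} {n : ℕ} {H : SimpleGraph W} {x : ℝ}
    {G : SimpleGraph (Fin n)} (hG : H.Free G) (hα : (G.indepNum : ℝ) < x) :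
    G.edgeSet.ncard ≤ maxEdges n H x := by
  refine le_csSup ⟨Nat.card (Sym2 (Fin n)), ?_⟩ ⟨G, hG, hα, rfl⟩
  rintro e ⟨G', -, -, rfl⟩
  exact Set.ncard_le_card _

theorem cliqueFree_of_K_free {n r : ℕ} {G : SimpleGraph (Fin n)} (h : (K r).Free G) :
    G.CliqueFree r := by
  simpa using SimpleGraph.cliqueFree_iff_top_free.mpr h

theorem K_free_of_cliqueFree {n r : ℕ} {G : SimpleGraph (Fin n)} (h : G.CliqueFree r) :
    (K r).Free G :=
  SimpleGraph.cliqueFree_iff_top_free.mp (by simpa using h)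

theorem density_nonneg {q : ℕ} (hq : 2 ≤ q) : 0 ≤ 1 / 2 * (1 - 1 / ((q : ℝ) - 1)) := by
  have : (2 : ℝ) ≤ q := by exact_mod_cast hq
  have : 1 / ((q : ℝ) - 1) ≤ 1 := by rw [div_le_one (by linarith)]; linarith
  linarith

theorem eventually_maxEdges_div_le {p q r : ℕ} (hp : 2 ≤ p) (hq : 2 ≤ q) (hr : r ≤ p * q)
    {ω : ℕ → ℝ} (hω : Tendsto ω atTop atTop) {g : ℕ → ℝ}
    (hg : ∀ᶠ n : ℕ in atTop, g n ≤ (Q p ⌈scale q ω n⌉₊ : ℝ)) {ε : ℝ} (hε : 0 < ε) :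
    ∀ᶠ n : ℕ in atTop, (maxEdges n (K r) (g n) : ℝ) / (n : ℝ) ^ 2 ≤
      1 / 2 * (1 - 1 / ((q : ℝ) - 1)) + ε := by
  have h0 := density_nonneg hq
  filter_upwards [eventually_ncard_edgeSet_le hp hq hω hε, hg, eventually_ge_atTop 1]
    with n hn hgn hn1
  have hn0 : (0 : ℝ) < n := by exact_mod_cast hn1
  rw [div_le_iff₀ (by positivity)]
  refine maxEdges_le (by positivity) fun G hG hα => hn G ?_ ?_
  · exact (cliqueFree_of_K_free hG).mono hr
  · exact_mod_cast lt_of_lt_of_le hα hgn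

theorem upperDensity_le {p q r : ℕ} (hp : 2 ≤ p) (hq : 2 ≤ q) (hr : r ≤ p * q)
    {ω : ℕ → ℝ} (hω : Tendsto ω atTop atTop) {g : ℕ → ℝ}
    (hg : ∀ᶠ n : ℕ in atTop, g n ≤ (Q p ⌈scale q ω n⌉₊ : ℝ)) :
    upperDensity (K r) g ≤ 1 / 2 * (1 - 1 / ((q : ℝ) - 1)) := by
  refine le_of_forall_pos_le_add fun ε hε => ?_
  refine limsup_le_of_le ?_ (eventually_maxEdges_div_le hp hq hr hω hg hε)
  exact isCoboundedUnder_le_of_le atTop (x := 0) fun n => by positivity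

end UpperBound

/-! ### Cliques and independent sets in the chain of twinned copies. -/

section Chain

variable {X : Type*} (B : SimpleGraph X) (u w : X)

/-- The graph obtained from `B` by adding a twin `none` of the vertex `u`, adjacent to `u`. -/
def twin : SimpleGraph (Option X) where
  Adj a b := a ≠ b ∧ (a.getD u = b.getD u ∨ B.Adj (a.getD u) (b.getD u))
  symm := ⟨fun _ _ h => ⟨h.1.symm, h.2.imp Eq.symm (fun h => h.symm)⟩⟩
  loopless := ⟨fun _ h => h.1 rfl⟩

/-- The pairs of vertices in consecutive parts of `chain` that are not joined. -/
def Unjoined (a b : ℕ × Option X) : Prop :=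
  b.1 = a.1 + 1 ∧ ((a.2 = some u ∧ b.2 ≠ some w ∧ ¬ (twin B u).Adj (some w) b.2) ∨
    (a.2 = none ∧ b.2 = some w))

/-- Copies of `twin B u` indexed by `ℕ`, any two of them completely joined, except that in the
next copy the vertex `u` sees only `w` and its neighbours, and its twin does not see `w`. -/
def chain : SimpleGraph (ℕ × Option X) where
  Adj a b := (a.1 = b.1 ∧ (twin B u).Adj a.2 b.2) ∨
    (a.1 ≠ b.1 ∧ ¬ Unjoined B u w a b ∧ ¬ Unjoined B u w b a)
  symm := ⟨fun _ _ h => h.imp (fun h => ⟨h.1.symm, h.2.symm⟩) (fun h => ⟨h.1.symm, h.2.2, h.2.1⟩)⟩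
  loopless := ⟨fun _ h => h.elim (fun h => h.2.1 rfl) (fun h => h.1 rfl)⟩

variable {B u w}

theorem getD_injOn_of_notMem {S : Finset (Option X)} (h : ¬ (none ∈ S ∧ some u ∈ S)) :
    Set.InjOn (fun o : Option X => o.getD u) S := by
  intro a ha b hb hab
  cases a <;> cases b <;> simp_all

theorem getD_injOn_of_isIndepSet_twin {S : Set (Option X)} (hS : (twin B u).IsIndepSet S) :
    Set.InjOn (fun o : Option X => o.getD u) S := by
  intro a ha b hb hab
  by_contra hne
  exact hS ha hb hne ⟨hne, Or.inl hab⟩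

theorem card_le_of_isIndepSet_twin [DecidableEq X] {α : ℕ}
    (hα : ∀ S : Finset X, B.IsIndepSet S → #S ≤ α) {S : Finset (Option X)}
    (hS : (twin B u).IsIndepSet S) : #S ≤ α := by
  rw [← card_image_of_injOn (getD_injOn_of_isIndepSet_twin hS)]
  refine hα _ ?_
  intro a ha b hb hab hadj
  simp only [coe_image, Set.mem_image, mem_coe] at ha hb
  obtain ⟨a, ha, rfl⟩ := ha
  obtain ⟨b, hb, rfl⟩ := hb
  have hne : a ≠ b := fun h => hab (by rw [h])
  exact hS ha hb hne ⟨hne, Or.inr hadj⟩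

/-- The vertex `w` can be added to `S`. -/
theorem card_lt_of_isIndepSet_twin [DecidableEq X] {α : ℕ}
    (hα : ∀ S : Finset X, B.IsIndepSet S → #S ≤ α) {S : Finset (Option X)}
    (hS : (twin B u).IsIndepSet S)
    (hw : ∀ x ∈ S, x ≠ some w ∧ ¬ (twin B u).Adj (some w) x) : #S + 1 ≤ α := by
  have hmem : some w ∉ S := fun h => (hw _ h).1 rfl
  rw [← card_insert_of_notMem hmem]
  refine card_le_of_isIndepSet_twin (u := u) hα ?_
  intro a ha b hb hab
  simp only [coe_insert, Set.mem_insert_iff, mem_coe] at ha hb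
  rcases ha with rfl | ha <;> rcases hb with rfl | hb
  · exact absurd rfl hab
  · exact (hw b hb).2
  · exact fun h => (hw a ha).2 h.symm
  · exact hS ha hb hab

theorem card_le_of_isClique_twin [DecidableEq X] {t : ℕ}
    (ht : ∀ S : Finset X, B.IsClique S → #S ≤ t) {S : Finset (Option X)}
    (hS : (twin B u).IsClique S) (hu : ¬ (none ∈ S ∧ some u ∈ S)) : #S ≤ t := by
  rw [← card_image_of_injOn (getD_injOn_of_notMem hu)]
  refine ht _ ?_
  intro a ha b hb hab
  simp only [coe_image, Set.mem_image, mem_coe] at ha hb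
  obtain ⟨a, ha, rfl⟩ := ha
  obtain ⟨b, hb, rfl⟩ := hb
  have hne : a ≠ b := fun h => hab (by rw [h])
  exact (hS ha hb hne).2.resolve_left hab

theorem card_le_succ_of_isClique_twin [DecidableEq X] {t : ℕ}
    (ht : ∀ S : Finset X, B.IsClique S → #S ≤ t) {S : Finset (Option X)}
    (hS : (twin B u).IsClique S) : #S ≤ t + 1 := by
  have h : #(S.erase none) ≤ t :=
    card_le_of_isClique_twin ht (hS.subset (coe_subset.mpr (erase_subset _ _))) (by simp)
  have := pred_card_le_card_erase (s := S) (a := none)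
  omega

/-- Adding `w` gives a clique, and it avoids the twin `none` because `u` and `w` are not adjacent;
so it still collapses injectively to a clique of `B`. -/
theorem card_lt_of_isClique_twin [DecidableEq X] {t : ℕ} (huw : u ≠ w) (hadj : ¬ B.Adj u w)
    (ht : ∀ S : Finset X, B.IsClique S → #S ≤ t) {S : Finset (Option X)}
    (hS : (twin B u).IsClique S) (hw : ∀ x ∈ S, (twin B u).Adj (some w) x) : #S + 1 ≤ t := by
  have hmem : some w ∉ S := fun h => (hw _ h).ne rfl
  rw [← card_insert_of_notMem hmem]
  refine card_le_of_isClique_twin (u := u) ht ?_ ?_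
  · intro a ha b hb hab
    simp only [coe_insert, Set.mem_insert_iff, mem_coe] at ha hb
    rcases ha with rfl | ha <;> rcases hb with rfl | hb
    · exact absurd rfl hab
    · exact hw b hb
    · exact (hw a ha).symm
    · exact hS ha hb hab
  · rintro ⟨h, -⟩
    have h' : none ∈ S := by simpa using h
    have := (hw _ h').2
    simp only [Option.getD_some, Option.getD_none] at this
    rcases this with h | h
    · exact huw h.symm
    · exact hadj h.symm

/-- The part of a set of vertices of `chain` in the copy with index `j`. -/
def slice [DecidableEq X] (S : Finset (ℕ × Option X)) (j : ℕ) : Finset (Option X) :=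
  {z ∈ S | z.1 = j}.image Prod.snd

theorem mem_slice [DecidableEq X] {S : Finset (ℕ × Option X)} {j : ℕ} {x : Option X} :
    x ∈ slice S j ↔ (j, x) ∈ S := by
  simp only [slice, mem_image, mem_filter]
  exact ⟨by rintro ⟨⟨i, y⟩, ⟨h, rfl⟩, rfl⟩; exact h, fun h => ⟨(j, x), ⟨h, rfl⟩, rfl⟩⟩

theorem card_slice [DecidableEq X] (S : Finset (ℕ × Option X)) (j : ℕ) :
    #(slice S j) = #{z ∈ S | z.1 = j} := by
  refine card_image_of_injOn ?_
  intro a ha b hb hab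
  simp only [coe_filter, Set.mem_ofPred_eq] at ha hb
  exact Prod.ext (ha.2.trans hb.2.symm) hab

/-- Every excess of one over `t` is repaid by the next term, so only an excess in the last term can
survive. -/
theorem sum_range_succ_le_of_drop {t : ℕ} {s : ℕ → ℕ} (h1 : ∀ j, s j ≤ t + 1)
    (h2 : ∀ j, t < s j → s (j + 1) + 1 ≤ t) (k : ℕ) :
    ∑ j ∈ range (k + 1), s j ≤ t * k + max t (s k) := by
  induction k with
  | zero => simp
  | succ k ih =>
    rw [sum_range_succ, mul_add, mul_one]
    have := h1 k
    rcases le_or_gt (s k) t with h | h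
    · rw [max_eq_left h] at ih; omega
    · have := h2 k h
      rw [max_eq_right h.le] at ih; omega

/-- A slice with more than `t` vertices contains both twins. Common neighbours of both in the next
copy are neighbours of `w`, so the next slice has fewer than `t` vertices. The last copy has no twin
and hence no excess. -/
theorem card_le_of_isClique_chain [DecidableEq X] {t r : ℕ} (huw : u ≠ w)
    (hadj : ¬ B.Adj u w) (ht : ∀ S : Finset X, B.IsClique S → #S ≤ t)
    {S : Finset (ℕ × Option X)} (hS : (chain B u w).IsClique S) (hr : ∀ z ∈ S, z.1 < r + 1)
    (hlast : (r, none) ∉ S) : #S ≤ t * (r + 1) := by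
  have hslice : ∀ j, (twin B u).IsClique (slice S j : Finset (Option X)) := by
    intro j a ha b hb hab
    have := hS (mem_slice.mp ha) (mem_slice.mp hb) (by simpa using hab)
    rcases this with h | h
    · exact h.2
    · exact absurd rfl h.1
  have hdrop : ∀ j, t < #(slice S j) → #(slice S (j + 1)) + 1 ≤ t := by
    intro j hj
    have hboth : none ∈ slice S j ∧ some u ∈ slice S j := by
      by_contra h
      have := card_le_of_isClique_twin ht (hslice j) h
      omega
    refine card_lt_of_isClique_twin huw hadj ht (hslice (j + 1)) fun x hx => ?_
    have hn := hS (mem_slice.mp hboth.1) (mem_slice.mp hx) (by simp)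
    have hu := hS (mem_slice.mp hboth.2) (mem_slice.mp hx) (by simp)
    rcases hn with hn | hn
    · exact absurd hn.1 (by simp)
    rcases hu with hu | hu
    · exact absurd hu.1 (by simp)
    by_contra hx'
    refine hu.2.1 ⟨rfl, Or.inl ⟨rfl, ?_, hx'⟩⟩
    rintro hxw
    exact hn.2.1 ⟨rfl, Or.inr ⟨rfl, hxw⟩⟩
  have hlast' : #(slice S r) ≤ t :=
    card_le_of_isClique_twin ht (hslice r) fun h => hlast (mem_slice.mp h.1)
  have hsum := sum_range_succ_le_of_drop
    (fun j => card_le_succ_of_isClique_twin ht (hslice j)) hdrop r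
  rw [max_eq_left hlast'] at hsum
  rw [card_eq_sum_card_fiberwise (f := Prod.fst) (t := range (r + 1))
    (fun z hz => by simpa using hr z hz)]
  simp only [← card_slice]
  linarith

/-- Only consecutive copies have unjoined pairs, so an independent set meets at most two copies. If
it meets two, it is either `u` together with vertices outside the closed neighbourhood of `w`, where
`w` could replace `u`, or the pair of `none` and `w`; the latter needs `2 ≤ α`. -/
theorem card_le_of_isIndepSet_chain [DecidableEq X] {α : ℕ} (hα2 : 2 ≤ α)
    (hα : ∀ S : Finset X, B.IsIndepSet S → #S ≤ α)
    {S : Finset (ℕ × Option X)} (hS : (chain B u w).IsIndepSet S) : #S ≤ α := by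
  have hslice : ∀ j, (twin B u).IsIndepSet (slice S j : Finset (Option X)) := by
    intro j a ha b hb hab h
    exact hS (mem_slice.mp ha) (mem_slice.mp hb) (by simpa using hab) (Or.inl ⟨rfl, h⟩)
  have hcross : ∀ a ∈ S, ∀ b ∈ S, a.1 < b.1 → Unjoined B u w a b := by
    intro a ha b hb hab
    have h := hS ha hb (fun h => by rw [h] at hab; exact lt_irrefl _ hab)
    by_contra hcon
    refine h (Or.inr ⟨hab.ne, hcon, fun h' => ?_⟩)
    have := h'.1
    omega
  by_cases hsame : ∃ a ∈ S, ∃ b ∈ S, a.1 < b.1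
  · obtain ⟨a, ha, b, hb, hab⟩ := hsame
    have hUab := hcross a ha b hb hab
    have hb1 := hUab.1
    have hidx : ∀ z ∈ S, z.1 = a.1 ∨ z.1 = b.1 := by
      intro z hz
      rcases lt_trichotomy z.1 a.1 with h | h | h
      · have := (hcross z hz b hb (by omega)).1; omega
      · exact Or.inl h
      · have := (hcross a ha z hz h).1; right; omega
    rcases hUab.2 with ⟨hau, hbw, -⟩ | ⟨han, hbw⟩
    · have hfirst : ∀ z ∈ S, z.1 = a.1 → z = a := by
        intro z hz hza
        rcases (hcross z hz b hb (by omega)).2 with h | h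
        · exact Prod.ext hza (h.1.trans hau.symm)
        · exact absurd h.2 hbw
      have hcard : #(slice S b.1) + 1 ≤ α := by
        refine card_lt_of_isIndepSet_twin (w := w) hα (hslice _) fun x hx => ?_
        rcases (hcross a ha _ (mem_slice.mp hx) hab).2 with h | h
        · exact h.2
        · rw [hau] at h; exact absurd h.1 (by simp)
      refine le_trans ?_ hcard
      rw [card_slice]
      have hsub : S ⊆ insert a {z ∈ S | z.1 = b.1} := by
        intro z hz
        rw [mem_insert, mem_filter]
        rcases hidx z hz with h | h
        · exact Or.inl (hfirst z hz h)
        · exact Or.inr ⟨hz, h⟩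
      exact (card_le_card hsub).trans (card_insert_le _ _)
    · have hsub : S ⊆ {a, b} := by
        intro z hz
        rw [mem_insert, mem_singleton]
        rcases hidx z hz with h | h
        · left
          rcases (hcross z hz b hb (by omega)).2 with h' | h'
          · exact absurd hbw h'.2.1
          · exact Prod.ext h (h'.1.trans han.symm)
        · right
          rcases (hcross a ha z hz (by omega)).2 with h' | h'
          · rw [han] at h'; exact absurd h'.1 (by simp)
          · exact Prod.ext h (h'.2.trans hbw.symm)
      exact ((card_le_card hsub).trans card_le_two).trans hα2
  · push Not at hsame
    rcases S.eq_empty_or_nonempty with rfl | ⟨a, ha⟩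
    · simp
    · have hall : {z ∈ S | z.1 = a.1} = S :=
        filter_true_of_mem fun z hz => le_antisymm (hsame a ha z hz) (hsame z hz a ha)
      have := card_le_of_isIndepSet_twin hα (hslice a.1)
      rwa [card_slice, hall] at this

end Chain

/-! ### The construction on `n` vertices, and the density. -/

section LowerBound

/-- The vertices of `Fin n` distributed over `r` copies of `Option (Fin m)`. -/
def place (n r m : ℕ) (x : Fin n) : ℕ × Option (Fin m) :=
  (x % r, if h : x / r < m then some ⟨x / r, h⟩ else none)

theorem place_injective {n r : ℕ} : Function.Injective (place n r (n / r)) := by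
  intro x y h
  simp only [place, Prod.mk.injEq] at h
  obtain ⟨h1, h2⟩ := h
  have hx : (x : ℕ) / r ≤ n / r := Nat.div_le_div_right x.2.le
  have hy : (y : ℕ) / r ≤ n / r := Nat.div_le_div_right y.2.le
  have hdiv : (x : ℕ) / r = y / r := by
    split_ifs at h2 with hx' hy' hy'
    · simpa using h2
    -- Both quotients are at least `n / r`, hence equal to it: each residue class has at most one
    -- vertex sent to `none`.
    · omega
  have := Nat.div_add_mod x r
  have := Nat.div_add_mod y r
  rw [Fin.ext_iff]
  rw [hdiv, h1] at *
  omega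

/-- A vertex there would be at least `(r + 1) * (n / (r + 1)) + r ≥ n`. -/
theorem place_ne_last {n r : ℕ} (x : Fin n) : place n (r + 1) (n / (r + 1)) x ≠ (r, none) := by
  intro h
  simp only [place, Prod.mk.injEq, dite_eq_right_iff, reduceCtorEq, imp_false, not_lt] at h
  have h1 := Nat.div_add_mod x (r + 1)
  have h2 := Nat.div_add_mod n (r + 1)
  have h3 := Nat.mod_lt n (Nat.add_one_pos r)
  have h4 := Nat.mul_le_mul_left (r + 1) h.2
  have := x.2
  omega

open scoped Classical in
theorem le_card_adj_comap_chain {n r : ℕ} (hr : 0 < r) (B : SimpleGraph (Fin (n / r)))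
    (u w : Fin (n / r)) :
    (n : ℝ) ^ 2 * (1 - 1 / r) - (4 * r + 1) * n ≤
      ∑ v, (#{y | ((chain B u w).comap (place n r (n / r))).Adj v y} : ℝ) := by
  set G := (chain B u w).comap (place n r (n / r)) with hG
  let Z : Finset (Fin n) := {x | (place n r (n / r) x).2 = none ∨
    (place n r (n / r) x).2 = some u}
  have hZ : #Z ≤ 2 * r := by
    calc #Z ≤ #(range r ×ˢ ({none, some u} : Finset (Option (Fin (n / r))))) := by
          refine card_le_card_of_injOn (place n r (n / r)) ?_ place_injective.injOn
          intro x hx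
          simp only [coe_filter, Set.mem_ofPred_eq, Z, mem_univ, true_and] at hx
          simp only [coe_product, Set.mem_prod, mem_coe, mem_range, mem_insert, mem_singleton]
          exact ⟨Nat.mod_lt _ hr, hx⟩
      _ ≤ r * 2 := by rw [card_product, card_range]; exact Nat.mul_le_mul_left _ card_le_two
      _ = 2 * r := mul_comm _ _
  have hclass : ∀ v : Fin n, #{y : Fin n | (y : ℕ) % r = (v : ℕ) % r} ≤ n / r + 1 := by
    intro v
    rw [← card_range (n / r + 1)]
    refine card_le_card_of_injOn (fun y : Fin n => (y : ℕ) / r) ?_ ?_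
    · intro y _
      simp only [coe_range, Set.mem_Iio]
      exact Nat.lt_succ_of_le (Nat.div_le_div_right y.2.le)
    · intro y hy z hz hyz
      simp only [coe_filter, Set.mem_ofPred_eq, mem_univ, true_and] at hy hz
      have h1 := Nat.div_add_mod y r
      have h2 := Nat.div_add_mod z r
      simp only at hyz
      rw [Fin.ext_iff, ← h1, ← h2, hyz, hy, hz]
  -- Every unjoined pair has an end in `Z`, so a vertex outside `Z` misses at most its own class and
  -- `Z`.
  have hdeg : ∀ v : Fin n, n ≤ #{y | G.Adj v y} + (n / r + 1) + 2 * r +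
      if v ∈ Z then n else 0 := by
    intro v
    by_cases hv : v ∈ Z
    · rw [if_pos hv]; exact Nat.le_add_left _ _
    · rw [if_neg hv, add_zero]
      let A : Finset (Fin n) := {y | G.Adj v y}
      let C : Finset (Fin n) := {y : Fin n | (y : ℕ) % r = (v : ℕ) % r}
      have hcover : (univ : Finset (Fin n)) ⊆ (A ∪ C) ∪ Z := by
        intro y _
        rw [mem_union, mem_union, mem_filter, mem_filter]
        by_contra! hcon
        obtain ⟨⟨h1, h2⟩, h3⟩ := hcon
        refine h1 (mem_univ _) (Or.inr ⟨fun h => h2 (mem_univ _) h.symm, ?_, ?_⟩)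
        · intro h
          refine hv (mem_filter.mpr ⟨mem_univ _, ?_⟩)
          rcases h.2 with h | h
          · exact Or.inr h.1
          · exact Or.inl h.1
        · intro h
          refine h3 (mem_filter.mpr ⟨mem_univ _, ?_⟩)
          rcases h.2 with h | h
          · exact Or.inr h.1
          · exact Or.inl h.1
      have h1 := card_le_card hcover
      rw [card_univ, Fintype.card_fin] at h1
      have h2 := card_union_le (A ∪ C) Z
      have h3 := card_union_le A C
      have h4 : #C ≤ n / r + 1 := hclass v
      change n ≤ #A + (n / r + 1) + 2 * r
      omega
  have hsum := sum_le_sum fun v (_ : v ∈ (univ : Finset (Fin n))) => hdeg v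
  simp only [sum_add_distrib, sum_const, card_univ, Fintype.card_fin, smul_eq_mul, sum_ite_mem,
    univ_inter] at hsum
  have hsum' : (n : ℝ) * n ≤ ∑ v, (#{y | G.Adj v y} : ℝ) + n * ((n / r : ℕ) + 1) +
      n * (2 * r) + #Z * n := by
    rw [← mul_add] at hsum
    exact_mod_cast hsum
  have hZ' : (#Z : ℝ) * n ≤ 2 * r * n := by
    have : (#Z : ℝ) ≤ 2 * r := by exact_mod_cast hZ
    gcongr
  have hdiv : (n : ℝ) * (n / r : ℕ) ≤ n * ((n : ℝ) / r) := by
    gcongr; exact Nat.cast_div_le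
  have : (n : ℝ) ^ 2 * (1 - 1 / r) = n * n - n * ((n : ℝ) / r) := by ring
  linarith

theorem exists_cliqueFree_indepNum_eq_Q {t : ℕ} (ht : 1 ≤ t) (m : ℕ) :
    ∃ B : SimpleGraph (Fin m), B.CliqueFree (t + 1) ∧ B.indepNum = Q (t + 1) m :=
  Nat.sInf_mem (s := {a | ∃ G : SimpleGraph (Fin m), G.CliqueFree (t + 1) ∧ G.indepNum = a})
    ⟨_, ⊥, SimpleGraph.cliqueFree_bot (by omega), rfl⟩

theorem exists_not_adj_of_cliqueFree {m t : ℕ} {B : SimpleGraph (Fin m)}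
    (hB : B.CliqueFree (t + 1)) (hm : t < m) : ∃ u w, u ≠ w ∧ ¬ B.Adj u w := by
  by_contra! h
  refine hB.mono hm univ ⟨fun a _ b _ hab => h a b hab, by simp⟩

/-- A graph with independence number at most `Q (t + 1) (n / (r + 1))` and clique number at most
`t * (r + 1)` that is close to the balanced complete `(r + 1)`-partite graph. -/
theorem exists_dense_cliqueFree {t r n : ℕ} (ht : 1 ≤ t) (hn : t < n / (r + 1)) :
    ∃ G : SimpleGraph (Fin n), G.CliqueFree (t * (r + 1) + 1) ∧
      G.indepNum ≤ Q (t + 1) (n / (r + 1)) ∧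
      (n : ℝ) ^ 2 * (1 - 1 / ((r : ℝ) + 1)) - (4 * ((r : ℝ) + 1) + 1) * n ≤
        2 * G.edgeSet.ncard := by
  classical
  obtain ⟨B, hB, hBα⟩ := exists_cliqueFree_indepNum_eq_Q ht (n / (r + 1))
  obtain ⟨u, w, huw, hadj⟩ := exists_not_adj_of_cliqueFree hB hn
  have hclique : ∀ S : Finset (Fin (n / (r + 1))), B.IsClique S → #S ≤ t := by
    intro S hS
    by_contra! h
    exact hB.mono h S ⟨hS, rfl⟩
  have hindep : ∀ S : Finset (Fin (n / (r + 1))), B.IsIndepSet S →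
      #S ≤ Q (t + 1) (n / (r + 1)) := by
    intro S hS
    rw [← hBα]
    exact hS.card_le_indepNum
  have htwo : 2 ≤ Q (t + 1) (n / (r + 1)) := by
    rw [← card_pair huw]
    refine hindep _ ?_
    intro a ha b hb hab
    simp only [coe_insert, coe_singleton, Set.mem_insert_iff, Set.mem_singleton_iff] at ha hb
    rcases ha with rfl | rfl <;> rcases hb with rfl | rfl
    · exact absurd rfl hab
    · exact hadj
    · exact fun h => hadj h.symm
    · exact absurd rfl hab
  let f : Fin n ↪ ℕ × Option (Fin (n / (r + 1))) := ⟨place n (r + 1) _, place_injective⟩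
  refine ⟨(chain B u w).comap f, ?_, ?_, ?_⟩
  · intro S hS
    have h : #(S.map f) ≤ t * (r + 1) := by
      refine card_le_of_isClique_chain huw hadj hclique ?_ ?_ ?_
      · intro a ha b hb hab
        simp only [coe_map, Set.mem_image, mem_coe] at ha hb
        obtain ⟨a, ha, rfl⟩ := ha
        obtain ⟨b, hb, rfl⟩ := hb
        exact hS.isClique ha hb (fun h => hab (by rw [h]))
      · intro z hz
        obtain ⟨x, -, rfl⟩ := mem_map.mp hz
        exact Nat.mod_lt _ (Nat.add_one_pos r)
      · intro hz
        obtain ⟨x, -, hx⟩ := mem_map.mp hz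
        exact place_ne_last x hx
    rw [card_map, hS.card_eq] at h
    omega
  · obtain ⟨S, hS⟩ := ((chain B u w).comap f).exists_isNIndepSet_indepNum
    rw [← hS.card_eq, ← card_map f]
    refine card_le_of_isIndepSet_chain (u := u) (w := w) htwo hindep ?_
    intro a ha b hb hab
    simp only [coe_map, Set.mem_image, mem_coe] at ha hb
    obtain ⟨a, ha, rfl⟩ := ha
    obtain ⟨b, hb, rfl⟩ := hb
    exact hS.isIndepSet ha hb (fun h => hab (by rw [h]))
  · rw [← sum_card_adj_eq_two_mul_ncard_edgeSet]
    have := le_card_adj_comap_chain (Nat.add_one_pos r) B u w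
    push_cast at this
    exact this

theorem eventually_le_maxEdges_div {t q s : ℕ} (ht : 1 ≤ t) (hq : 2 ≤ q)
    (hs : t * (q - 1) < s) {g : ℕ → ℝ}
    (hg : ∀ᶠ n : ℕ in atTop, (Q (t + 1) (n / (q - 1)) : ℝ) < g n) {ε : ℝ} (hε : 0 < ε) :
    ∀ᶠ n : ℕ in atTop, 1 / 2 * (1 - 1 / ((q : ℝ) - 1)) - ε ≤
      (maxEdges n (K s) (g n) : ℝ) / (n : ℝ) ^ 2 := by
  obtain ⟨r, rfl⟩ : ∃ r, q = r + 2 := ⟨q - 2, by omega⟩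
  have hr : r + 2 - 1 = r + 1 := rfl
  have hr' : ((r + 2 : ℕ) : ℝ) - 1 = (r : ℝ) + 1 := by push_cast; ring
  rw [hr] at hs hg
  rw [hr']
  -- The first threshold gives each copy more than `t` vertices, hence a non-adjacent pair `u`, `w`;
  -- the second absorbs the linear error.
  filter_upwards [hg, eventually_ge_atTop ((t + 1) * (r + 1)),
    tendsto_natCast_atTop_atTop.eventually_ge_atTop ((4 * ((r : ℝ) + 1) + 1) / (2 * ε)),
    eventually_ge_atTop 1] with n hgn hn hnε hn1
  obtain ⟨G, hG, hGα, hGe⟩ := exists_dense_cliqueFree (r := r) (n := n) ht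
    (by rw [Nat.lt_iff_add_one_le, Nat.le_div_iff_mul_le (Nat.add_one_pos r)]; exact hn)
  have hmax : (G.edgeSet.ncard : ℝ) ≤ maxEdges n (K s) (g n) := by
    exact_mod_cast ncard_edgeSet_le_maxEdges (K_free_of_cliqueFree (hG.mono hs))
      (lt_of_le_of_lt (by exact_mod_cast hGα) hgn)
  have hn0 : (0 : ℝ) < n := by exact_mod_cast hn1
  rw [div_le_iff₀ (by positivity)] at hnε
  rw [le_div_iff₀ (by positivity)]
  have := mul_le_mul_of_nonneg_right hnε hn0.le
  nlinarith

theorem hasDensity_K {p q t s : ℕ} (hp : 2 ≤ p) (hq : 2 ≤ q) (ht : 1 ≤ t) (hs : s ≤ p * q)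
    (hts : t * (q - 1) < s) {ω : ℕ → ℝ} (hω : Tendsto ω atTop atTop) {g : ℕ → ℝ}
    (hg : ∀ᶠ n : ℕ in atTop, (Q (t + 1) (n / (q - 1)) : ℝ) < g n ∧
      g n ≤ (Q p ⌈scale q ω n⌉₊ : ℝ)) :
    HasDensity (K s) g (1 / 2 * (1 - 1 / ((q : ℝ) - 1))) := by
  have hgQ := hg.mono fun n h => h.2
  have hupper := upperDensity_le hp hq hs hω hgQ
  have hbdd : IsBoundedUnder (· ≤ ·) atTop
      (fun n : ℕ => (maxEdges n (K s) (g n) : ℝ) / (n : ℝ) ^ 2) :=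
    ⟨_, eventually_map.mpr (eventually_maxEdges_div_le hp hq hs hω hgQ one_pos)⟩
  have hbdd' : IsBoundedUnder (· ≥ ·) atTop
      (fun n : ℕ => (maxEdges n (K s) (g n) : ℝ) / (n : ℝ) ^ 2) :=
    ⟨0, eventually_map.mpr (Eventually.of_forall fun n => by positivity)⟩
  have hlower : 1 / 2 * (1 - 1 / ((q : ℝ) - 1)) ≤ lowerDensity (K s) g := by
    refine le_of_forall_sub_le fun ε hε => ?_
    exact le_liminf_of_le hbdd.isCoboundedUnder_ge
      (eventually_le_maxEdges_div ht hq hts (hg.mono fun n h => h.1) hε)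
  have hle : lowerDensity (K s) g ≤ upperDensity (K s) g := liminf_le_limsup hbdd hbdd'
  exact ⟨le_antisymm hupper (hlower.trans hle), le_antisymm (hle.trans hupper) hlower⟩

end LowerBound

end RamseyTuran

theorem mainTheorem3 (p q : ℕ) (hp : 2 ≤ p) (hq : 2 ≤ q) (ω : ℕ → ℝ)
    (hω : Filter.Tendsto ω Filter.atTop Filter.atTop) :
    RamseyTuran.upperDensity (RamseyTuran.K (p * q))
        (fun n => (RamseyTuran.Q p ⌈RamseyTuran.scale q ω n⌉₊ : ℝ))
      ≤ 1 / 2 * (1 - 1 / ((q : ℝ) - 1)) ∧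
    ∀ i t : ℕ, i ≤ p - 1 → t = (p * q - i - 1) / (q - 1) →
      p ≤ t ∧
      ∀ g : ℕ → ℝ,
        (∀ᶠ n : ℕ in Filter.atTop,
          (RamseyTuran.Q (t + 1) (n / (q - 1)) : ℝ) < g n ∧
          g n ≤ (RamseyTuran.Q p ⌈RamseyTuran.scale q ω n⌉₊ : ℝ)) →
        RamseyTuran.HasDensity (RamseyTuran.K (p * q - i)) g
          (1 / 2 * (1 - 1 / ((q : ℝ) - 1))) := by
  refine ⟨RamseyTuran.upperDensity_le hp hq le_rfl hω (Filter.Eventually.of_forall fun _ => le_rfl),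
    fun i t hi ht => ?_⟩
  obtain ⟨r, rfl⟩ : ∃ r, q = r + 2 := ⟨q - 2, by omega⟩
  have hr : r + 2 - 1 = r + 1 := rfl
  have hpq : p * (r + 2) = p * (r + 1) + p := by ring
  -- Since `i ≤ p - 1`, the numerator is at least `p * (q - 1)`.
  have hpt : p ≤ t := by
    rw [ht, hr, Nat.le_div_iff_mul_le (Nat.add_one_pos r)]
    omega
  -- The `- 1` in the numerator of `t` makes this strict, so the construction contains no
  -- `K_{pq-i}`.
  have hts : t * (r + 2 - 1) < p * (r + 2) - i := by
    have h := Nat.div_mul_le_self (p * (r + 2) - i - 1) (r + 2 - 1)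
    rw [← ht] at h
    omega
  exact ⟨hpt, fun g hg => RamseyTuran.hasDensity_K hp hq (by omega) (Nat.sub_le _ _) hts hω hg⟩
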